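/- A continuous map $f:U\to\mathbb{C}$ on an open set $U\subset\mathbb{C}$ is called $K$-quasiregular, $1\le K<\infty$, if $f\in W^{1,2}_{\mathrm{loc}}(U)$ and $|f_{\bar z}|\le\frac{K-1}{K+1}|f_z|$ almost everywhere in $U$, and quasiregular if it is $K$-quasiregular for some $K$; its dilatation constant $K(f)$ is the least such $K$. A map is called quasiregular on a closed annulus if it is continuous there and quasiregular in the interior; its dilatation constant is the one in the interior. **Proposition.** Let $r>0$, $c\in\mathbb{C}\setminus\{0\}$, and let $n,M$ be positive integers with $M>n$. There exists a quasiregular map $$g=g_{n,M,r,c}:\{z\in\mathbb{C}: r\le|z|\le r e^{\pi/n}\}\to\{z\in\mathbb{C}: |z|\le |c|\,r^{n}e^{M\pi/n}\}$$ such that 1. $g(z)=c\,z^{n}$ if $|z|=r$, 2. $g(z)=c\,z^{M}/r^{M-n}$ if $|z|=r e^{\pi/n}$, and 3. $K(g)$ depends only on $M/n$, and not otherwise on $M$, $n$, $r$ or $c$; that is, there is a function $\kappa:\mathbb{Q}\to\mathbb{R}$ such that, for all $r,c,n,M$ as above, $g_{n,M,r,c}$ can be chosen with $K(g_{n,M,r,c})=\kappa(M/n)$.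 -/

import Mathlib

open MeasureTheory Set
open scoped ContDiff

/-- `h` is a weak derivative of `f` on the open set `U ⊆ ℂ` in the real direction `v`
(`v = 1` for `∂/∂x`, `v = Complex.I` for `∂/∂y`): integration by parts holds against all smooth
real test functions with compact support in `U`. -/
def HasWeakDerivOn (f h : ℂ → ℂ) (v : ℂ) (U : Set ℂ) : Prop :=
  ∀ φ : ℂ → ℝ, ContDiff ℝ ∞ φ → HasCompactSupport φ → tsupport φ ⊆ U →
    ∫ z, (fderiv ℝ φ z v) • f z = - ∫ z, φ z • h z

/-- `h ∈ L²_loc(U)`. -/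
def MemL2Loc (h : ℂ → ℂ) (U : Set ℂ) : Prop :=
  ∀ C : Set ℂ, IsCompact C → C ⊆ U → MemLp h 2 (volume.restrict C)

/-- `f` is `K`-quasiregular on the open set `U`: it is continuous, belongs to `W^{1,2}_loc(U)` with
weak partial derivatives `fx`, `fy`, and `|f_zbar| ≤ k |f_z|` almost everywhere on `U`, where
`k = (K - 1) / (K + 1)`, `f_z = (fx - i fy) / 2` and `f_zbar = (fx + i fy) / 2`. -/
def IsKQuasiregularOn (K : ℝ) (f : ℂ → ℂ) (U : Set ℂ) : Prop :=
  1 ≤ K ∧ ContinuousOn f U ∧ ∃ fx fy : ℂ → ℂ,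
    HasWeakDerivOn f fx 1 U ∧ HasWeakDerivOn f fy Complex.I U ∧
    MemL2Loc fx U ∧ MemL2Loc fy U ∧
    ∀ᵐ z ∂(volume.restrict U),
      ‖(fx z + Complex.I * fy z) / 2‖ ≤ (K - 1) / (K + 1) * ‖(fx z - Complex.I * fy z) / 2‖

/-- `f` is quasiregular on the open set `U`. -/
def IsQuasiregularOn (f : ℂ → ℂ) (U : Set ℂ) : Prop :=
  ∃ K : ℝ, IsKQuasiregularOn K f U

/-- The dilatation constant `K(f)` of a quasiregular map on `U`: the least `K ≥ 1` such that `f` is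
`K`-quasiregular on `U`. -/
noncomputable def dilatationConst (f : ℂ → ℂ) (U : Set ℂ) : ℝ :=
  sInf {K : ℝ | IsKQuasiregularOn K f U}

/-- The open annulus `A(a, b)`. -/
def openAnnulus (a b : ℝ) : Set ℂ := {z | a < ‖z‖ ∧ ‖z‖ < b}

/-- The closed annulus `a ≤ |z| ≤ b`. -/
def closedAnnulus (a b : ℝ) : Set ℂ := {z | a ≤ ‖z‖ ∧ ‖z‖ ≤ b}

/-! Let M/n = p/q in lowest terms, n = dq, M = dp. If g₀ interpolates between z^q and z^p on 1 ≤ |z|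
≤ e^{π/q}, then c r^n g₀((z/r)^d) has the required boundary values. Since (z/r)^d maps the open
annulus holomorphically, without critical points, onto the model annulus, this map is K-quasiregular
for exactly the same K as g₀. So κ(M/n) is the dilatation constant of g₀, which never has to be
computed.

For g₀, start from α e^{iqθ} + β e^{ipθ} with α, β functions of x = log|z| (`exists_profile`,
`twoModeMap`). In the coordinate x + iθ, the two sides of the Beltrami inequality are |A + Bv| with
A, B real and v = e^{i(p-q)θ}. As |A + Bv|² is affine in Re v, only v = ±1 matters. With S = α + β,
D = α - β and b = (p-q)/(p+q), the case v = 1 asks that S' be comparable to S - bD, and v = -1 that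
D' be comparable to D - bS, sign included. The latter changes sign, so S is taken linear and D
solves D' = const · (D - bS).

The outer modulus Λ of this map is arbitrary; `radialStretch`, which fixes the unit circle
pointwise, corrects it to e^{pπ/q}. Everything is C¹ off the origin, so quasiregularity is a
pointwise condition on classical derivatives (`isKQuasiregularOn_iff_of_contDiffOn`). -/

/-- The Beltrami inequality `|A_zbar| ≤ k |A_z|` for a real-linear map `A : ℂ → ℂ`. -/
def BeltramiBound (k : ℝ) (A : ℂ →L[ℝ] ℂ) : Prop :=
  ‖A 1 + Complex.I * A Complex.I‖ ≤ k * ‖A 1 - Complex.I * A Complex.I‖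

/-! ### Weak versus classical derivatives of C¹ maps -/

theorem integrable_smul_of_tsupport_subset {φ : ℂ → ℝ} {h : ℂ → ℂ} {U : Set ℂ}
    (hφ : Continuous φ) (hc : HasCompactSupport φ) (hU : tsupport φ ⊆ U)
    (hh : ContinuousOn h U) : Integrable fun z => φ z • h z := by
  have h1 : IntegrableOn (fun z => φ z • h z) (tsupport φ) :=
    (hφ.continuousOn.smul (hh.mono hU)).integrableOn_compact hc
  refine (integrableOn_iff_integrable_of_support_subset ?_).1 h1
  intro z hz
  apply subset_tsupport
  intro h0
  exact hz (by simp [h0])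

theorem integral_fderiv_smul_eq_neg {f : ℂ → ℂ} {U : Set ℂ} (hU : IsOpen U)
    (hf : ContDiffOn ℝ 1 f U) (v : ℂ) {φ : ℂ → ℝ} (hφ : ContDiff ℝ ∞ φ)
    (hc : HasCompactSupport φ) (hs : tsupport φ ⊆ U) :
    ∫ z, (fderiv ℝ φ z v) • f z = - ∫ z, φ z • fderiv ℝ f z v := by
  have hf' : ContinuousOn (fun z => fderiv ℝ f z v) U :=
    (hf.continuousOn_fderiv_of_isOpen hU le_rfl).clm_apply continuousOn_const
  have hφ' : Continuous (fun z => fderiv ℝ φ z v) :=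
    (hφ.continuous_fderiv (by simp)).clm_apply continuous_const
  have hsub : tsupport (fun z => fderiv ℝ φ z v) ⊆ tsupport φ := by
    refine closure_minimal ?_ (isClosed_tsupport φ)
    intro z hz
    apply tsupport_fderiv_subset ℝ
    apply subset_tsupport
    intro h0
    exact hz (by simp [h0])
  have hc' : HasCompactSupport (fun z => fderiv ℝ φ z v) :=
    hc.mono' ((subset_tsupport _).trans hsub)
  have key := integral_bilinear_hasLineDerivAt_right_eq_neg_left_of_integrable
    (μ := (volume : Measure ℂ)) (f := φ) (f' := fun z => fderiv ℝ φ z v) (g := f)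
    (g' := fun z => fderiv ℝ f z v) (v := v) (B := ContinuousLinearMap.lsmul ℝ ℝ)
    (integrable_smul_of_tsupport_subset hφ' hc' (hsub.trans hs) hf.continuousOn)
    (integrable_smul_of_tsupport_subset hφ.continuous hc hs hf')
    (integrable_smul_of_tsupport_subset hφ.continuous hc hs hf.continuousOn)
    (fun z _ => ((hφ.differentiable (by simp)) z).hasFDerivAt.hasLineDerivAt v)
    (fun z hz => ((hf.differentiableOn one_ne_zero).differentiableAt
      (hU.mem_nhds (hs hz))).hasFDerivAt.hasLineDerivAt v)
  simp only [ContinuousLinearMap.lsmul_apply] at key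
  rw [key, neg_neg]

theorem ContinuousOn.memL2Loc {h : ℂ → ℂ} {U : Set ℂ} (hh : ContinuousOn h U) :
    MemL2Loc h U := by
  intro C hC hCU
  have : IsFiniteMeasure ((volume : Measure ℂ).restrict C) :=
    isFiniteMeasure_restrict.2 hC.measure_ne_top
  obtain ⟨R, hR⟩ := hC.exists_bound_of_continuousOn (hh.mono hCU)
  refine MemLp.of_bound ((hh.mono hCU).aestronglyMeasurable hC.measurableSet) R ?_
  exact (ae_restrict_iff' hC.measurableSet).2 (Filter.Eventually.of_forall hR)

theorem MemL2Loc.locallyIntegrableOn {h : ℂ → ℂ} {U : Set ℂ} (hU : IsOpen U)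
    (hh : MemL2Loc h U) : LocallyIntegrableOn h U := by
  rw [locallyIntegrableOn_iff hU.isLocallyClosed]
  intro C hCU hC
  have : IsFiniteMeasure ((volume : Measure ℂ).restrict C) :=
    isFiniteMeasure_restrict.2 hC.measure_ne_top
  exact (hh C hC hCU).integrable (by norm_num)

/-- Weak derivatives of a `C¹` function are almost everywhere the classical ones. -/
theorem HasWeakDerivOn.ae_eq_fderiv {f h : ℂ → ℂ} {v : ℂ} {U : Set ℂ} (hU : IsOpen U)
    (hf : ContDiffOn ℝ 1 f U) (hw : HasWeakDerivOn f h v U) (hh : MemL2Loc h U) :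
    ∀ᵐ z, z ∈ U → h z = fderiv ℝ f z v := by
  have hf' : ContinuousOn (fun z => fderiv ℝ f z v) U :=
    (hf.continuousOn_fderiv_of_isOpen hU le_rfl).clm_apply continuousOn_const
  have hli := hh.locallyIntegrableOn hU
  have hli' := hf'.memL2Loc.locallyIntegrableOn hU
  have key := hU.ae_eq_zero_of_integral_contDiff_smul_eq_zero (hli.sub hli') ?_
  · filter_upwards [key] with z hz hzU
    exact sub_eq_zero.1 (hz hzU)
  · intro φ hφ hc hs
    have e1 := hw φ hφ hc hs
    rw [integral_fderiv_smul_eq_neg hU hf v hφ hc hs, neg_inj] at e1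
    have i1 : Integrable fun z => φ z • h z := by
      have h1 : IntegrableOn h (tsupport φ) :=
        (locallyIntegrableOn_iff hU.isLocallyClosed).1 hli _ hs hc
      have h2 : IntegrableOn (fun z => φ z • h z) (tsupport φ) :=
        h1.continuousOn_smul hφ.continuous.continuousOn hc
      refine (integrableOn_iff_integrable_of_support_subset ?_).1 h2
      intro z hz
      apply subset_tsupport
      intro h0
      exact hz (by simp [h0])
    have i2 := integrable_smul_of_tsupport_subset hφ.continuous hc hs hf'
    simp only [Pi.sub_apply, smul_sub]
    rw [integral_sub i1 i2, e1, sub_self]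

/-- For `C¹` maps quasiregularity is a pointwise condition on the classical derivative. -/
theorem isKQuasiregularOn_iff_of_contDiffOn {K : ℝ} {f : ℂ → ℂ} {U : Set ℂ} (hU : IsOpen U)
    (hf : ContDiffOn ℝ 1 f U) :
    IsKQuasiregularOn K f U ↔
      1 ≤ K ∧ ∀ z ∈ U, BeltramiBound ((K - 1) / (K + 1)) (fderiv ℝ f z) := by
  have hf' (v : ℂ) : ContinuousOn (fun z => fderiv ℝ f z v) U :=
    (hf.continuousOn_fderiv_of_isOpen hU le_rfl).clm_apply continuousOn_const
  have half (k : ℝ) (a b : ℂ) : ‖a / 2‖ ≤ k * ‖b / 2‖ ↔ ‖a‖ ≤ k * ‖b‖ := by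
    rw [norm_div, norm_div, ← mul_div_assoc]
    exact div_le_div_iff_of_pos_right (by simp)
  constructor
  · rintro ⟨hK, -, fx, fy, hx, hy, hx2, hy2, hae⟩
    refine ⟨hK, ?_⟩
    rw [ae_restrict_iff' hU.measurableSet] at hae
    have hae' : ∀ᵐ z, z ∈ U → BeltramiBound ((K - 1) / (K + 1)) (fderiv ℝ f z) := by
      filter_upwards [hae, hx.ae_eq_fderiv hU hf hx2, hy.ae_eq_fderiv hU hf hy2] with z h1 h2 h3 hz
      have := h1 hz
      rw [half, h2 hz, h3 hz] at this
      exact this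
    set N : ℂ → ℝ := fun z =>
      (K - 1) / (K + 1) * ‖fderiv ℝ f z 1 - Complex.I * fderiv ℝ f z Complex.I‖ -
        ‖fderiv ℝ f z 1 + Complex.I * fderiv ℝ f z Complex.I‖ with hN
    have hNc : ContinuousOn N U :=
      (continuousOn_const.mul ((hf' 1).sub (continuousOn_const.mul (hf' Complex.I))).norm).sub
        ((hf' 1).add (continuousOn_const.mul (hf' Complex.I))).norm
    -- By continuity the inequality fails on an open set; being null, that set is empty.
    have hopen : IsOpen (U ∩ N ⁻¹' Iio 0) := hNc.isOpen_inter_preimage hU isOpen_Iio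
    have hnull : volume (U ∩ N ⁻¹' Iio 0) = 0 := by
      refine measure_mono_null ?_ (ae_iff.1 hae')
      rintro z ⟨hz, hz'⟩ hcon
      have h4 := hcon hz
      have h5 : N z < 0 := hz'
      simp only [BeltramiBound, hN] at h4 h5
      linarith
    have hempty := hopen.measure_eq_zero_iff _ |>.1 hnull
    intro z hz
    by_contra hcon
    have : z ∈ U ∩ N ⁻¹' Iio 0 := ⟨hz, by
      simp only [BeltramiBound] at hcon
      simp only [hN, mem_preimage, mem_Iio]
      linarith⟩
    rw [hempty] at this
    exact this
  · rintro ⟨hK, hb⟩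
    refine ⟨hK, hf.continuousOn, fun z => fderiv ℝ f z 1, fun z => fderiv ℝ f z Complex.I,
      fun φ h1 h2 h3 => integral_fderiv_smul_eq_neg hU hf 1 h1 h2 h3,
      fun φ h1 h2 h3 => integral_fderiv_smul_eq_neg hU hf Complex.I h1 h2 h3,
      (hf' 1).memL2Loc, (hf' Complex.I).memL2Loc, ?_⟩
    refine (ae_restrict_iff' hU.measurableSet).2 (Filter.Eventually.of_forall fun z hz => ?_)
    rw [half]
    exact hb z hz

/-! ### Linear algebra of the Beltrami inequality -/

theorem beltrami_decomposition (A : ℂ →L[ℝ] ℂ) (v : ℂ) :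
    A v = (A 1 - Complex.I * A Complex.I) / 2 * v +
      (A 1 + Complex.I * A Complex.I) / 2 * (starRingEnd ℂ) v := by
  have h : A v = v.re * A 1 + v.im * A Complex.I := by
    conv_lhs => rw [← Complex.re_add_im v]
    have e1 : (v.re : ℂ) = v.re • (1 : ℂ) := by simp
    have e2 : (v.im : ℂ) * Complex.I = v.im • Complex.I := by simp
    rw [map_add, e2, e1, map_smul, map_smul]
    simp
  rw [h]
  apply Complex.ext <;> simp <;> ring

/-- The Jacobian |a|² - |b|² is multiplicative, which bounds it below by (1 - k₁²)(1 - k₂²)N², while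
|b| ≤ (k₁ + k₂)N, where N = |a₁||a₂|. The new constant stays below 1. -/
theorem BeltramiBound.comp {k₁ k₂ : ℝ} {A B : ℂ →L[ℝ] ℂ} (hA : BeltramiBound k₁ A)
    (hB : BeltramiBound k₂ B) (h₁ : 0 ≤ k₁) (h₁' : k₁ < 1) (h₂ : 0 ≤ k₂) (h₂' : k₂ < 1) :
    BeltramiBound ((k₁ + k₂) / (1 + k₁ * k₂)) (A.comp B) := by
  have hpos : 0 < 1 + k₁ * k₂ := by positivity
  set a₁ := (A 1 - Complex.I * A Complex.I) / 2 with ha₁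
  set b₁ := (A 1 + Complex.I * A Complex.I) / 2 with hb₁
  set a₂ := (B 1 - Complex.I * B Complex.I) / 2 with ha₂
  set b₂ := (B 1 + Complex.I * B Complex.I) / 2 with hb₂
  have hA' : ‖b₁‖ ≤ k₁ * ‖a₁‖ := by
    simp only [BeltramiBound] at hA
    rw [ha₁, hb₁, norm_div, norm_div, ← mul_div_assoc]
    gcongr
  have hB' : ‖b₂‖ ≤ k₂ * ‖a₂‖ := by
    simp only [BeltramiBound] at hB
    rw [ha₂, hb₂, norm_div, norm_div, ← mul_div_assoc]
    gcongr
  have hcomp (v : ℂ) : A.comp B v = (a₁ * a₂ + b₁ * (starRingEnd ℂ) b₂) * v +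
      (a₁ * b₂ + b₁ * (starRingEnd ℂ) a₂) * (starRingEnd ℂ) v := by
    rw [ContinuousLinearMap.comp_apply, beltrami_decomposition A, beltrami_decomposition B v,
      ← ha₁, ← hb₁, ← ha₂, ← hb₂]
    simp only [map_add, map_mul, Complex.conj_conj]
    ring
  have I2 : Complex.I * Complex.I = -1 := Complex.I_mul_I
  have ha : A.comp B 1 - Complex.I * A.comp B Complex.I =
      2 * (a₁ * a₂ + b₁ * (starRingEnd ℂ) b₂) := by
    rw [hcomp, hcomp]
    simp only [map_one, Complex.conj_I]
    linear_combination (-(a₁ * a₂ + b₁ * (starRingEnd ℂ) b₂) +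
      (a₁ * b₂ + b₁ * (starRingEnd ℂ) a₂)) * I2
  have hb : A.comp B 1 + Complex.I * A.comp B Complex.I =
      2 * (a₁ * b₂ + b₁ * (starRingEnd ℂ) a₂) := by
    rw [hcomp, hcomp]
    simp only [map_one, Complex.conj_I]
    linear_combination ((a₁ * a₂ + b₁ * (starRingEnd ℂ) b₂) -
      (a₁ * b₂ + b₁ * (starRingEnd ℂ) a₂)) * I2
  rw [BeltramiBound, ha, hb, norm_mul, norm_mul]
  set a := a₁ * a₂ + b₁ * (starRingEnd ℂ) b₂ with hadef
  set b := a₁ * b₂ + b₁ * (starRingEnd ℂ) a₂ with hbdef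
  have hjac : ‖a‖ ^ 2 - ‖b‖ ^ 2 = (‖a₁‖ ^ 2 - ‖b₁‖ ^ 2) * (‖a₂‖ ^ 2 - ‖b₂‖ ^ 2) := by
    rw [hadef, hbdef]
    simp only [Complex.sq_norm, Complex.normSq_apply, Complex.add_re, Complex.add_im,
      Complex.mul_re, Complex.mul_im, Complex.conj_re, Complex.conj_im]
    ring
  set N := ‖a₁‖ * ‖a₂‖ with hN
  have hN0 : 0 ≤ N := by positivity
  have hbN : ‖b‖ ≤ (k₁ + k₂) * N := by
    calc ‖b‖ ≤ ‖a₁ * b₂‖ + ‖b₁ * (starRingEnd ℂ) a₂‖ := norm_add_le _ _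
      _ = ‖a₁‖ * ‖b₂‖ + ‖b₁‖ * ‖a₂‖ := by
        rw [norm_mul, norm_mul, RCLike.norm_conj]
      _ ≤ ‖a₁‖ * (k₂ * ‖a₂‖) + (k₁ * ‖a₁‖) * ‖a₂‖ := by gcongr
      _ = (k₁ + k₂) * N := by rw [hN]; ring
  have hsq₁ : (1 - k₁ ^ 2) * ‖a₁‖ ^ 2 ≤ ‖a₁‖ ^ 2 - ‖b₁‖ ^ 2 := by
    have := pow_le_pow_left₀ (norm_nonneg _) hA' 2
    rw [mul_pow] at this
    linarith
  have hsq₂ : (1 - k₂ ^ 2) * ‖a₂‖ ^ 2 ≤ ‖a₂‖ ^ 2 - ‖b₂‖ ^ 2 := by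
    have := pow_le_pow_left₀ (norm_nonneg _) hB' 2
    rw [mul_pow] at this
    linarith
  have hc₁ : 0 ≤ 1 - k₁ ^ 2 := by nlinarith
  have hc₂ : 0 ≤ 1 - k₂ ^ 2 := by nlinarith
  have hJ : (1 - k₁ ^ 2) * (1 - k₂ ^ 2) * N ^ 2 ≤ ‖a‖ ^ 2 - ‖b‖ ^ 2 := by
    rw [hjac]
    calc _ = ((1 - k₁ ^ 2) * ‖a₁‖ ^ 2) * ((1 - k₂ ^ 2) * ‖a₂‖ ^ 2) := by rw [hN]; ring
      _ ≤ _ := mul_le_mul hsq₁ hsq₂ (by positivity) (le_trans (by positivity) hsq₁)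
  have hbsq : ‖b‖ ^ 2 ≤ (k₁ + k₂) ^ 2 * N ^ 2 := by
    rw [← mul_pow]
    exact pow_le_pow_left₀ (norm_nonneg _) hbN 2
  -- Uses (1 + k₁k₂)² = (k₁ + k₂)² + (1 - k₁²)(1 - k₂²).
  have hfin : ((1 + k₁ * k₂) * ‖b‖) ^ 2 ≤ ((k₁ + k₂) * ‖a‖) ^ 2 := by
    have e1 := mul_le_mul_of_nonneg_left hbsq (mul_nonneg hc₁ hc₂)
    have e2 := mul_le_mul_of_nonneg_left hJ (sq_nonneg (k₁ + k₂))
    nlinarith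
  have h3 := (pow_le_pow_iff_left₀ (by positivity) (by positivity) two_ne_zero).1 hfin
  have : ‖b‖ ≤ (k₁ + k₂) / (1 + k₁ * k₂) * ‖a‖ := by
    rw [div_mul_eq_mul_div, le_div_iff₀ hpos]
    linarith
  linarith [mul_le_mul_of_nonneg_left this (norm_nonneg (2 : ℂ))]

/-- Precomposing with multiplication by w multiplies the linear coefficient by w and the antilinear
one by its conjugate, so their ratio keeps its modulus. -/
theorem beltramiBound_comp_smul_one_iff {k : ℝ} {A : ℂ →L[ℝ] ℂ} {w : ℂ} (hw : w ≠ 0) :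
    BeltramiBound k (A.comp (w • (1 : ℂ →L[ℝ] ℂ))) ↔ BeltramiBound k A := by
  have I2 : Complex.I * Complex.I = -1 := Complex.I_mul_I
  have h (v : ℂ) : A.comp (w • (1 : ℂ →L[ℝ] ℂ)) v = A (w * v) := by simp
  have e1 : A (w * 1) + Complex.I * A (w * Complex.I) =
      (A 1 + Complex.I * A Complex.I) * (starRingEnd ℂ) w := by
    rw [beltrami_decomposition A (w * 1), beltrami_decomposition A (w * Complex.I)]
    simp only [map_one, map_mul, Complex.conj_I]
    linear_combination ((A 1 - Complex.I * A Complex.I) / 2 * w -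
      (A 1 + Complex.I * A Complex.I) / 2 * (starRingEnd ℂ) w) * I2
  have e2 : A (w * 1) - Complex.I * A (w * Complex.I) =
      (A 1 - Complex.I * A Complex.I) * w := by
    rw [beltrami_decomposition A (w * 1), beltrami_decomposition A (w * Complex.I)]
    simp only [map_one, map_mul, Complex.conj_I]
    linear_combination (-(A 1 - Complex.I * A Complex.I) / 2 * w +
      (A 1 + Complex.I * A Complex.I) / 2 * (starRingEnd ℂ) w) * I2
  rw [BeltramiBound, BeltramiBound, h, h, e1, e2, norm_mul, norm_mul, RCLike.norm_conj,
    ← mul_assoc]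
  exact mul_le_mul_iff_left₀ (norm_pos_iff.2 hw)

theorem beltramiBound_smul_iff {k : ℝ} {A : ℂ →L[ℝ] ℂ} {c : ℂ} (hc : c ≠ 0) :
    BeltramiBound k (c • A) ↔ BeltramiBound k A := by
  have e1 : (c • A) 1 + Complex.I * (c • A) Complex.I = c * (A 1 + Complex.I * A Complex.I) := by
    simp only [smul_apply, smul_eq_mul]; ring
  have e2 : (c • A) 1 - Complex.I * (c • A) Complex.I = c * (A 1 - Complex.I * A Complex.I) := by
    simp only [smul_apply, smul_eq_mul]; ring
  rw [BeltramiBound, BeltramiBound, e1, e2, norm_mul, norm_mul, mul_left_comm]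
  exact mul_le_mul_iff_right₀ (norm_pos_iff.2 hc)

/-! ### The radial profiles -/

theorem abs_sub_le_mul_abs_add {x y K : ℝ} (hK : 1 ≤ K) (hx : 0 < x) (hy : 0 < y)
    (hxy : x ≤ K * y) (hyx : y ≤ K * x) : |x - y| ≤ (K - 1) / (K + 1) * |x + y| := by
  rw [abs_of_pos (add_pos hx hy), div_mul_eq_mul_div, le_div_iff₀ (by linarith), ← le_div_iff₀
    (by linarith), abs_le]
  constructor
  · rw [neg_le, le_div_iff₀ (by linarith)]; nlinarith
  · rw [le_div_iff₀ (by linarith)]; nlinarith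

theorem norm_add_mul_sq {v : ℂ} (hv : ‖v‖ = 1) (a b : ℝ) :
    ‖(a : ℂ) + b * v‖ ^ 2 = ((a + b) ^ 2 * (1 + v.re) + (a - b) ^ 2 * (1 - v.re)) / 2 := by
  have h1 : v.re * v.re + v.im * v.im = 1 := by
    rw [← Complex.normSq_apply, ← Complex.sq_norm, hv, one_pow]
  rw [Complex.sq_norm, Complex.normSq_apply]
  simp only [Complex.add_re, Complex.add_im, Complex.mul_re, Complex.mul_im, Complex.ofReal_re,
    Complex.ofReal_im]
  linear_combination b ^ 2 * h1

/-- A bound at `v = 1` and `v = -1` for `a + b v` and `a' + b' v` gives one on the unit circle. -/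
theorem norm_add_mul_le_of_abs_le {v : ℂ} (hv : ‖v‖ = 1) {a b a' b' k : ℝ} (hk : 0 ≤ k)
    (h₁ : |a + b| ≤ k * |a' + b'|) (h₂ : |a - b| ≤ k * |a' - b'|) :
    ‖(a : ℂ) + b * v‖ ≤ k * ‖(a' : ℂ) + b' * v‖ := by
  rw [← pow_le_pow_iff_left₀ (norm_nonneg _) (by positivity) two_ne_zero, mul_pow,
    norm_add_mul_sq hv, norm_add_mul_sq hv]
  have hre := abs_le.1 (hv ▸ Complex.abs_re_le_norm v)
  have e1 := pow_le_pow_left₀ (abs_nonneg _) h₁ 2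
  have e2 := pow_le_pow_left₀ (abs_nonneg _) h₂ 2
  rw [mul_pow, sq_abs, sq_abs] at e1 e2
  have e3 := mul_le_mul_of_nonneg_right e1 (by linarith [hre.1] : 0 ≤ 1 + v.re)
  have e4 := mul_le_mul_of_nonneg_right e2 (by linarith [hre.2] : 0 ≤ 1 - v.re)
  linarith

/-- A positive time at which `(b + 2 + 2 t - (1 + b) e ^ t) + (1 + 2 t / b)` vanishes, with
nonnegativity before it. -/
theorem exists_profile_time {b : ℝ} (hb : 0 < b) (hb1 : b < 1) :
    ∃ L : ℝ, 0 < L ∧ (b + 2 + 2 * L - (1 + b) * Real.exp L) + (1 + 2 / b * L) = 0 ∧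
      ∀ t ∈ Icc 0 L, 0 ≤ (b + 2 + 2 * t - (1 + b) * Real.exp t) + (1 + 2 / b * t) := by
  set F : ℝ → ℝ := fun t => (b + 2 + 2 * t - (1 + b) * Real.exp t) + (1 + 2 / b * t) with hF
  have hFc : Continuous F := by fun_prop
  have hF0 : F 0 = 2 := by simp [hF]; ring
  -- Chosen so that 2/b = (N - 4)/2, which makes the bound at N polynomial once exp is replaced by
  -- its quadratic minorant.
  set N : ℝ := 4 / b + 4 with hN
  have hNpos : 0 < N := by positivity
  have hFN : F N ≤ 0 := by
    have h1 := Real.quadratic_le_exp_of_nonneg hNpos.le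
    have h2 : 2 / b = (N - 4) / 2 := by rw [hN]; ring
    have h3 : 4 < N := by rw [hN]; linarith [div_pos (by norm_num : (0 : ℝ) < 4) hb]
    have h4 : (1 + b) * (1 + N + N ^ 2 / 2) ≤ (1 + b) * Real.exp N := by gcongr
    simp only [hF]
    rw [h2]
    nlinarith [mul_pos hb hNpos, mul_pos hb (pow_pos hNpos 2)]
  obtain ⟨L, hL, hL0⟩ := intermediate_value_Icc' hNpos.le hFc.continuousOn
    (show (0 : ℝ) ∈ Icc (F N) (F 0) from ⟨hFN, by rw [hF0]; norm_num⟩)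
  have hLpos : 0 < L := by
    rcases hL.1.lt_or_eq with h | h
    · exact h
    · rw [← h, hF0] at hL0; norm_num at hL0
  refine ⟨L, hLpos, hL0, fun t ht => ?_⟩
  change 0 ≤ F t
  -- F is concave, positive at 0 and zero at L, hence nonnegative between them.
  set θ := t / L with hθ
  have hθ0 : 0 ≤ θ := div_nonneg ht.1 hLpos.le
  have hθ1 : θ ≤ 1 := (div_le_one hLpos).2 ht.2
  have htθ : t = θ * L := by rw [hθ]; field_simp
  have hexp : Real.exp t ≤ (1 - θ) + θ * Real.exp L := by
    have := convexOn_exp.2 (mem_univ 0) (mem_univ L) (sub_nonneg.2 hθ1) hθ0 (by ring)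
    simpa [htθ] using this
  have hL0' : (b + 2 + 2 * L - (1 + b) * Real.exp L) + (1 + 2 / b * L) = 0 := hL0
  have h5 : (1 + b) * Real.exp t ≤ (1 + b) * ((1 - θ) + θ * Real.exp L) := by gcongr
  simp only [hF]
  have h6 : 2 / b * t = θ * (2 / b * L) := by rw [htθ]; ring
  rw [h6]
  have h7 : 2 * t = θ * (2 * L) := by rw [htθ]; ring
  rw [h7]
  nlinarith

/-- Coefficients for which `α (log |z|) e^{iqθ} + β (log |z|) e^{ipθ}` interpolates, on
`0 ≤ log |z| ≤ ℓ`, between a multiple of `e^{iqθ}` and one of `e^{ipθ}`. The two inequalities are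
the Beltrami bounds in the directions where `e^{i(p-q)θ} = ±1`. -/
theorem exists_profile {p q ℓ : ℝ} (hq : 0 < q) (hqp : q < p) (hℓ : 0 < ℓ) :
    ∃ (α β α' β' : ℝ → ℝ) (Λ k : ℝ), ContDiff ℝ 1 α ∧ ContDiff ℝ 1 β ∧
      (∀ x, HasDerivAt α (α' x) x) ∧ (∀ x, HasDerivAt β (β' x) x) ∧
      1 < Λ ∧ 0 ≤ k ∧ k < 1 ∧ α 0 = 1 ∧ β 0 = 0 ∧ α ℓ = 0 ∧ β ℓ = Λ ∧
      ∀ x ∈ Icc 0 ℓ, 0 ≤ α x ∧ 0 ≤ β x ∧ α x + β x ≤ Λ ∧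
        |(α' x - q * α x) + (β' x - p * β x)| ≤ k * |(α' x + q * α x) + (β' x + p * β x)| ∧
        |(α' x - q * α x) - (β' x - p * β x)| ≤ k * |(α' x + q * α x) - (β' x + p * β x)| := by
  have hp : 0 < p := hq.trans hqp
  set b : ℝ := (p - q) / (p + q) with hb
  have hb0 : 0 < b := div_pos (by linarith) (by linarith)
  have hb1 : b < 1 := (div_lt_one (by linarith)).2 (by linarith)
  obtain ⟨L, hL, hL0, hLnn⟩ := exists_profile_time hb0 hb1
  -- Rescales time so that D reaches -S, that is α vanishes, exactly at x = ℓ.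
  set κ : ℝ := L / ℓ with hκ
  have hκ0 : 0 < κ := div_pos hL hℓ
  have hκℓ : κ * ℓ = L := by rw [hκ]; field_simp
  -- With t = κx, bS = b + 2t and D - bS = 2 - (1 + b)e^t, so D solves D' = κ(D - bS) and S(0) =
  -- D(0) = 1.
  set S : ℝ → ℝ := fun x => 1 + 2 / b * (κ * x) with hS
  set D : ℝ → ℝ := fun x => b + 2 + 2 * (κ * x) - (1 + b) * Real.exp (κ * x) with hD
  have hSd (x : ℝ) : HasDerivAt S (κ * (2 / b)) x := by
    have h := (((hasDerivAt_id x).const_mul κ).const_mul (2 / b)).const_add 1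
    exact h.congr_deriv (by ring)
  have hDd (x : ℝ) : HasDerivAt D (κ * (D x - b * S x)) x := by
    have h0 := (hasDerivAt_id x).const_mul κ
    have h := ((h0.const_mul 2).const_add (b + 2)).sub (h0.exp.const_mul (1 + b))
    refine h.congr_deriv ?_
    simp only [hD, hS, id]
    field_simp
    ring
  have hSc : ContDiff ℝ 1 S := by fun_prop
  have hDc : ContDiff ℝ 1 D := by fun_prop
  set Λ : ℝ := S ℓ with hΛ
  set σ : ℝ := κ * (2 / b) with hσ
  set m : ℝ := (p + q) / 2 * (1 - b) with hm
  set m' : ℝ := (p + q) * Λ with hm'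
  set lam : ℝ := 2 * κ / (p + q) with hlam
  have hσ0 : 0 < σ := by positivity
  have hΛ1 : 1 < Λ := by
    have : 0 < 2 / b * (κ * ℓ) := by positivity
    rw [hΛ, hS]; linarith
  have hm0 : 0 < m := mul_pos (by linarith) (by linarith)
  have hm'0 : 0 < m' := mul_pos (by linarith) (by linarith)
  have hlam0 : 0 < lam := div_pos (by linarith) (by linarith)
  -- A crude sum dominating every ratio compared below: σ is S', m and m' bound (p+q)/2 · (S - bD),
  -- and lam is the constant ratio of D' to (p+q)/2 · (D - bS).
  set K : ℝ := 1 + σ / m + m' / σ + lam + 1 / lam with hK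
  have t1 : 0 < σ / m := by positivity
  have t2 : 0 < m' / σ := by positivity
  have t3 : 0 < 1 / lam := by positivity
  have hK1 : 1 ≤ K := by linarith
  refine ⟨fun x => (S x + D x) / 2, fun x => (S x - D x) / 2,
    fun x => (σ + κ * (D x - b * S x)) / 2, fun x => (σ - κ * (D x - b * S x)) / 2,
    Λ, (K - 1) / (K + 1), (hSc.add hDc).div_const 2, (hSc.sub hDc).div_const 2,
    fun x => ((hSd x).add (hDd x)).div_const 2, fun x => ((hSd x).sub (hDd x)).div_const 2,
    hΛ1, div_nonneg (by linarith) (by linarith), (div_lt_one (by linarith)).2 (by linarith),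
    ?_, ?_, ?_, ?_, ?_⟩
  · simp [hS, hD]; ring
  · simp [hS, hD]; ring
  · simp only [hS, hD, hκℓ]; linarith
  · have : D ℓ = - S ℓ := by simp only [hS, hD, hκℓ]; linarith
    simp only [this, hΛ]; ring
  intro x hx
  have hκx : κ * x ∈ Icc 0 L :=
    ⟨mul_nonneg hκ0.le hx.1, by rw [← hκℓ]; exact mul_le_mul_of_nonneg_left hx.2 hκ0.le⟩
  have hα : 0 ≤ S x + D x := by
    have := hLnn _ hκx
    simp only [hS, hD]; linarith
  have hb2 : 2 ≤ 2 / b := by rw [le_div_iff₀ hb0]; linarith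
  have hβ : 0 ≤ S x - D x := by
    have e1 : (1 + b) * (κ * x + 1) ≤ (1 + b) * Real.exp (κ * x) := by
      gcongr; exact Real.add_one_le_exp _
    have e2 := mul_le_mul_of_nonneg_right hb2 hκx.1
    have e3 := mul_nonneg hb0.le hκx.1
    have e4 := hκx.1
    simp only [hS, hD]
    linarith
  have hSΛ : S x ≤ Λ := by
    simp only [hΛ, hS]
    have := hx.2
    gcongr
  have hS1 : 1 ≤ S x := by
    have : 0 ≤ 2 / b * (κ * x) := mul_nonneg (by positivity) hκx.1
    simp only [hS]; linarith
  have hbs : p - q = b * (p + q) := by rw [hb]; field_simp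
  have hpq : 0 < p + q := by linarith
  clear_value K m m' lam σ Λ
  clear hSc hDc hSd hDd
  clear_value S D κ b
  refine ⟨by linarith, by linarith, by linarith, ?_, ?_⟩
  · set T := (p + q) / 2 * (S x - b * D x) with hT
    have hTm : m ≤ T := by
      rw [hm, hT]
      have : 1 - b ≤ S x - b * D x := by nlinarith
      gcongr
    have hTm' : T ≤ m' := by
      rw [hm', hT]
      have : S x - b * D x ≤ 2 * Λ := by nlinarith
      calc (p + q) / 2 * (S x - b * D x) ≤ (p + q) / 2 * (2 * Λ) := by gcongr
        _ = _ := by ring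
    have hT0 : 0 < T := hm0.trans_le hTm
    have e1 : σ ≤ K * T := by
      calc σ = σ / m * m := by field_simp
        _ ≤ K * T := mul_le_mul (by linarith) hTm hm0.le (by linarith)
    have e2 : T ≤ K * σ := by
      calc T ≤ m' := hTm'
        _ = m' / σ * σ := by field_simp
        _ ≤ K * σ := by gcongr; linarith
    have key := abs_sub_le_mul_abs_add hK1 hσ0 hT0 e1 e2
    have i1 : ((σ + κ * (D x - b * S x)) / 2 - q * ((S x + D x) / 2)) +
        ((σ - κ * (D x - b * S x)) / 2 - p * ((S x - D x) / 2)) = σ - T := by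
      rw [hT]; linear_combination (D x / 2) * hbs
    have i2 : ((σ + κ * (D x - b * S x)) / 2 + q * ((S x + D x) / 2)) +
        ((σ - κ * (D x - b * S x)) / 2 + p * ((S x - D x) / 2)) = σ + T := by
      rw [hT]; linear_combination (-D x / 2) * hbs
    rw [← i1, ← i2] at key
    exact key
  -- Both sides are fixed multiples of W, so the bound survives where W vanishes.
  · set W := (p + q) / 2 * (D x - b * S x) with hW
    have e1 : lam ≤ K * 1 := by linarith
    have e2 : 1 ≤ K * lam := by
      calc (1 : ℝ) = 1 / lam * lam := by field_simp
        _ ≤ K * lam := by gcongr; linarith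
    have key := mul_le_mul_of_nonneg_right
      (abs_sub_le_mul_abs_add hK1 hlam0 one_pos e1 e2) (abs_nonneg W)
    rw [mul_assoc, ← abs_mul, ← abs_mul] at key
    have hlW : lam * W = κ * (D x - b * S x) := by rw [hlam, hW]; field_simp
    have i1 : ((σ + κ * (D x - b * S x)) / 2 - q * ((S x + D x) / 2)) -
        ((σ - κ * (D x - b * S x)) / 2 - p * ((S x - D x) / 2)) = (lam - 1) * W := by
      rw [sub_mul, hlW, hW]; linear_combination (S x / 2) * hbs
    have i2 : ((σ + κ * (D x - b * S x)) / 2 + q * ((S x + D x) / 2)) -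
        ((σ - κ * (D x - b * S x)) / 2 + p * ((S x - D x) / 2)) = (lam + 1) * W := by
      rw [add_mul, hlW, hW]; linear_combination (-S x / 2) * hbs
    rw [← i1, ← i2] at key
    exact key

/-! ### The radial stretch -/

/-- The radial stretch `w ↦ w ((1 + |w|²) / 2) ^ γ`. -/
noncomputable def radialStretch (γ : ℝ) (w : ℂ) : ℂ :=
  (((1 + ‖w‖ ^ 2) / 2) ^ γ : ℝ) • w

/-- The base (1 + |w|²)/2 is at least 1/2, so the stretch is smooth even at 0, a value the two-mode
map takes inside the annulus. -/
theorem radialStretch_contDiff (γ : ℝ) : ContDiff ℝ 1 (radialStretch γ) := by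
  unfold radialStretch
  refine ContDiff.smul (ContDiff.rpow_const_of_ne ?_ fun w => by positivity) contDiff_id
  exact (contDiff_const.add (contDiff_norm_sq ℝ)).div_const 2

theorem radialStretch_of_norm_eq_one (γ : ℝ) {w : ℂ} (hw : ‖w‖ = 1) :
    radialStretch γ w = w := by
  simp [radialStretch, hw]

/-- The ratio is |γ||w|² / (1 + (1 + γ)|w|²), whose supremum is approached as |w| → ∞. It is below 1
exactly because γ > -1/2. -/
theorem beltramiBound_fderiv_radialStretch {γ : ℝ} (hγ : -1 / 2 < γ) (w : ℂ) :
    BeltramiBound (|γ| / (1 + γ)) (fderiv ℝ (radialStretch γ) w) := by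
  set u : ℝ := (1 + ‖w‖ ^ 2) / 2 with hu
  have hu0 : 0 < u := by positivity
  have h1 : HasFDerivAt (fun w : ℂ => (1 + ‖w‖ ^ 2) / 2) (innerSL ℝ w) w := by
    have h := ((hasStrictFDerivAt_norm_sq w).hasFDerivAt.const_add 1).mul_const (2⁻¹ : ℝ)
    refine h.congr_fderiv ?_
    ext v
    simp
    ring
  have h2 : HasFDerivAt (fun w : ℂ => ((1 + ‖w‖ ^ 2) / 2) ^ γ) ((γ * u ^ (γ - 1)) • innerSL ℝ w) w :=
    h1.rpow_const (Or.inl hu0.ne')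
  have h3 := h2.smul (hasFDerivAt_id w)
  have h4 : fderiv ℝ (radialStretch γ) w = _ := h3.fderiv
  have huγ : u ^ γ = u ^ (γ - 1) * u := by
    rw [← Real.rpow_add_one hu0.ne']; ring_nf
  set m := u ^ (γ - 1) with hm
  have hm0 : 0 < m := Real.rpow_pos_of_pos hu0 _
  have hA (v : ℂ) : fderiv ℝ (radialStretch γ) w v =
      m * u * v + γ * m * (w.re * v.re + w.im * v.im) * w := by
    rw [h4]
    simp [← hu, huγ, Complex.inner]
    ring_nf
    simp
  have e1 : fderiv ℝ (radialStretch γ) w 1 +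
      Complex.I * fderiv ℝ (radialStretch γ) w Complex.I = (γ * m : ℝ) * w ^ 2 := by
    rw [hA, hA]
    apply Complex.ext <;> simp [pow_two] <;> ring
  have e2 : fderiv ℝ (radialStretch γ) w 1 -
      Complex.I * fderiv ℝ (radialStretch γ) w Complex.I =
        (m * (1 + (1 + γ) * ‖w‖ ^ 2) : ℝ) := by
    rw [hA, hA, Complex.sq_norm, Complex.normSq_apply, hu, Complex.sq_norm, Complex.normSq_apply]
    apply Complex.ext <;> simp <;> ring
  have hγ1 : 0 < 1 + γ := by linarith
  rw [BeltramiBound, e1, e2, norm_mul, norm_pow, Complex.norm_real, Complex.norm_real,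
    Real.norm_eq_abs, Real.norm_eq_abs, abs_mul, abs_of_pos hm0,
    abs_of_pos (show 0 < m * (1 + (1 + γ) * ‖w‖ ^ 2) by positivity), div_mul_eq_mul_div,
    le_div_iff₀ hγ1]
  have : 0 ≤ |γ| * m := by positivity
  nlinarith

theorem abs_div_one_add_lt_one {γ : ℝ} (hγ : -1 / 2 < γ) : |γ| / (1 + γ) < 1 := by
  rw [div_lt_one (by linarith), abs_lt]
  constructor <;> linarith

theorem norm_radialStretch (γ : ℝ) (w : ℂ) :
    ‖radialStretch γ w‖ = ((1 + ‖w‖ ^ 2) / 2) ^ γ * ‖w‖ := by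
  rw [radialStretch, norm_smul, Real.norm_eq_abs, abs_of_nonneg (by positivity)]

theorem norm_radialStretch_mono {γ : ℝ} (hγ : -1 / 2 < γ) {w w' : ℂ} (h : ‖w‖ ≤ ‖w'‖) :
    ‖radialStretch γ w‖ ≤ ‖radialStretch γ w'‖ := by
  -- The square of the modulus becomes a product of two factors that are visibly nondecreasing in ρ
  -- when 2γ + 1 ≥ 0.
  have aux (ρ : ℝ) (hρ : 0 ≤ ρ) : (((1 + ρ ^ 2) / 2) ^ γ * ρ) ^ 2 =
      ((1 + ρ ^ 2) / 2) ^ (2 * γ + 1) * (2 * (1 - 1 / (1 + ρ ^ 2))) := by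
    have hu0 : 0 < (1 + ρ ^ 2) / 2 := by positivity
    rw [mul_pow, Real.rpow_add_one hu0.ne', ← Real.rpow_natCast, ← Real.rpow_mul hu0.le]
    rw [mul_comm γ, Nat.cast_ofNat]
    field_simp
    ring
  rw [norm_radialStretch, norm_radialStretch,
    ← pow_le_pow_iff_left₀ (by positivity) (by positivity) two_ne_zero, aux _ (norm_nonneg _),
    aux _ (norm_nonneg _)]
  have h2 : 0 ≤ 1 - 1 / (1 + ‖w‖ ^ 2) := by
    rw [sub_nonneg, div_le_one (by positivity)]
    nlinarith [sq_nonneg ‖w‖]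
  have h3 : 0 ≤ 2 * γ + 1 := by linarith
  gcongr

/-- The stretch factor can be adjusted so that `Λ` goes to a given `R ≥ 2`. -/
theorem exists_stretch_exponent {Λ R : ℝ} (hΛ : 1 < Λ) (hR : 2 ≤ R) :
    ∃ γ : ℝ, -1 / 2 < γ ∧ ((1 + Λ ^ 2) / 2) ^ γ * Λ = R := by
  have hu : 1 < (1 + Λ ^ 2) / 2 := by nlinarith
  have hl : 0 < Real.log ((1 + Λ ^ 2) / 2) := Real.log_pos hu
  have hΛ0 : 0 < Λ := by linarith
  have hR0 : 0 < R := by linarith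
  refine ⟨Real.log (R / Λ) / Real.log ((1 + Λ ^ 2) / 2), ?_, ?_⟩
  -- The condition γ > -1/2 amounts to 2Λ² < R²(1 + Λ²).
  · rw [lt_div_iff₀ hl, div_mul_eq_mul_div, div_lt_iff₀ two_pos, neg_one_mul,
      ← Real.log_inv, mul_comm, ← Nat.cast_ofNat (R := ℝ), ← Real.log_pow]
    apply Real.log_lt_log (by positivity)
    rw [div_pow, lt_div_iff₀ (by positivity), inv_div, div_mul_eq_mul_div,
      div_lt_iff₀ (by positivity)]
    push_cast
    have hR4 : 4 ≤ R ^ 2 := by nlinarith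
    nlinarith [mul_le_mul_of_nonneg_right hR4 (by positivity : 0 ≤ 1 + Λ ^ 2)]
  · rw [Real.rpow_def_of_pos (by linarith), mul_div_cancel₀ _ hl.ne', Real.exp_log (by positivity)]
    field_simp

/-! ### The two-mode map and the model -/

theorem HasFDerivAt.comp_hasDerivAt_complex {f P : ℂ → ℂ} {A : ℂ →L[ℝ] ℂ} {z w : ℂ}
    (hf : HasFDerivAt f A (P z)) (hP : HasDerivAt P w z) :
    HasFDerivAt (fun z => f (P z)) (A.comp (w • (1 : ℂ →L[ℝ] ℂ))) z :=
  hf.comp z hP.complexToReal_fderiv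

/-- `α (log |z|) e^{iqθ} + β (log |z|) e^{ipθ}`, where `θ = arg z`. -/
noncomputable def twoModeMap (α β : ℝ → ℝ) (q p : ℕ) (z : ℂ) : ℂ :=
  α (Real.log ‖z‖) * (z / ‖z‖) ^ q + β (Real.log ‖z‖) * (z / ‖z‖) ^ p

theorem twoModeMap_contDiffOn {α β : ℝ → ℝ} (hα : ContDiff ℝ 1 α) (hβ : ContDiff ℝ 1 β)
    (q p : ℕ) : ContDiffOn ℝ 1 (twoModeMap α β q p) {0}ᶜ := by
  intro z hz
  have hz0 : z ≠ 0 := hz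
  have hn : ContDiffAt ℝ 1 (fun z : ℂ => ‖z‖) z := contDiffAt_norm ℝ hz0
  have hnC : ContDiffAt ℝ 1 (fun z : ℂ => (‖z‖ : ℂ)) z :=
    Complex.ofRealCLM.contDiff.contDiffAt.comp z hn
  have hl : ContDiffAt ℝ 1 (fun z : ℂ => Real.log ‖z‖) z := hn.log (norm_ne_zero_iff.2 hz0)
  have hdir : ContDiffAt ℝ 1 (fun z : ℂ => z / ‖z‖) z := by
    simp only [div_eq_mul_inv]
    exact contDiffAt_id.mul (hnC.inv (by simpa using hz0))
  have hαC : ContDiffAt ℝ 1 (fun z : ℂ => (α (Real.log ‖z‖) : ℂ)) z :=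
    Complex.ofRealCLM.contDiff.contDiffAt.comp z (hα.contDiffAt.comp z hl)
  have hβC : ContDiffAt ℝ 1 (fun z : ℂ => (β (Real.log ‖z‖) : ℂ)) z :=
    Complex.ofRealCLM.contDiff.contDiffAt.comp z (hβ.contDiffAt.comp z hl)
  exact ((hαC.mul (hdir.pow q)).add (hβC.mul (hdir.pow p))).contDiffWithinAt

theorem twoModeMap_exp (α β : ℝ → ℝ) (q p : ℕ) (ζ : ℂ) :
    twoModeMap α β q p (Complex.exp ζ) =
      α ζ.re * Complex.exp (q * (ζ.im * Complex.I)) +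
        β ζ.re * Complex.exp (p * (ζ.im * Complex.I)) := by
  have h : Complex.exp ζ / (‖Complex.exp ζ‖ : ℂ) = Complex.exp (ζ.im * Complex.I) := by
    rw [Complex.norm_exp, div_eq_iff (by simp), Complex.ofReal_exp,
      ← Complex.exp_add]
    congr 1
    rw [add_comm, Complex.re_add_im]
  rw [twoModeMap, h, ← Complex.exp_nat_mul, ← Complex.exp_nat_mul, Complex.norm_exp, Real.log_exp]

theorem hasFDerivAt_mul_exp_im {a : ℝ → ℝ} {a' : ℝ} {ζ : ℂ} (ha : HasDerivAt a a' ζ.re) (n : ℕ) :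
    ∃ A : ℂ →L[ℝ] ℂ,
      HasFDerivAt (fun ζ : ℂ => (a ζ.re : ℂ) * Complex.exp (n * (ζ.im * Complex.I))) A ζ ∧
      A 1 = a' * Complex.exp (n * (ζ.im * Complex.I)) ∧
      A Complex.I = Complex.I * (n * a ζ.re) * Complex.exp (n * (ζ.im * Complex.I)) := by
  have h1 : HasFDerivAt (fun ζ : ℂ => (a ζ.re : ℂ)) _ ζ :=
    Complex.ofRealCLM.hasFDerivAt.comp ζ (ha.hasFDerivAt.comp ζ Complex.reCLM.hasFDerivAt)
  have h2 : HasFDerivAt (fun ζ : ℂ => (n : ℂ) * ((ζ.im : ℂ) * Complex.I)) _ ζ :=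
    ((Complex.ofRealCLM.hasFDerivAt.comp ζ Complex.imCLM.hasFDerivAt).mul_const
      Complex.I).const_mul (n : ℂ)
  refine ⟨_, h1.mul h2.cexp, ?_, ?_⟩
  · simp [mul_comm]
  · simp
    ring

/-- Precomposition with the conformal map exp changes neither side's ratio, so the bound is checked
in the coordinate log z, where the common unimodular factor e^{iqθ} drops out. -/
theorem beltramiBound_fderiv_twoModeMap {α β α' β' : ℝ → ℝ} (hα : ContDiff ℝ 1 α)
    (hβ : ContDiff ℝ 1 β) {q p : ℕ} {k : ℝ} (hk : 0 ≤ k) (hqp : q ≤ p) {z : ℂ} (hz : z ≠ 0)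
    (hα' : ∀ x, HasDerivAt α (α' x) x) (hβ' : ∀ x, HasDerivAt β (β' x) x) {x : ℝ}
    (hx : x = Real.log ‖z‖)
    (h₁ : |(α' x - q * α x) + (β' x - p * β x)| ≤ k * |(α' x + q * α x) + (β' x + p * β x)|)
    (h₂ : |(α' x - q * α x) - (β' x - p * β x)| ≤ k * |(α' x + q * α x) - (β' x + p * β x)|) :
    BeltramiBound k (fderiv ℝ (twoModeMap α β q p) z) := by
  set ζ := Complex.log z with hζ
  have hexp : Complex.exp ζ = z := Complex.exp_log hz
  have hre : ζ.re = x := by rw [hζ, Complex.log_re, hx]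
  obtain ⟨A, hA, hA1, hAI⟩ := hasFDerivAt_mul_exp_im (hα' ζ.re) q
  obtain ⟨B, hB, hB1, hBI⟩ := hasFDerivAt_mul_exp_im (hβ' ζ.re) p
  have hdiff : DifferentiableAt ℝ (twoModeMap α β q p) (Complex.exp ζ) := by
    rw [hexp]
    exact ((twoModeMap_contDiffOn hα hβ q p).differentiableOn one_ne_zero).differentiableAt
      (isOpen_compl_singleton.mem_nhds hz)
  have hcomp := hdiff.hasFDerivAt.comp_hasDerivAt_complex (Complex.hasDerivAt_exp ζ)
  simp only [twoModeMap_exp] at hcomp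
  have heq := hcomp.unique (hA.add hB)
  rw [← hexp, ← beltramiBound_comp_smul_one_iff (Complex.exp_ne_zero ζ), heq]
  set v := Complex.exp (((p - q : ℕ) : ℂ) * (ζ.im * Complex.I)) with hv
  have hv1 : ‖v‖ = 1 := by
    rw [hv, Complex.norm_exp]; simp
  set e := Complex.exp (q * (ζ.im * Complex.I)) with he
  have he1 : ‖e‖ = 1 := by
    rw [he, Complex.norm_exp]; simp
  have hev : Complex.exp (p * (ζ.im * Complex.I)) = e * v := by
    rw [he, hv, ← Complex.exp_add, ← add_mul, ← Nat.cast_add, Nat.add_sub_cancel' hqp]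
  have I2 : Complex.I * Complex.I = -1 := Complex.I_mul_I
  have e1 : (A + B) 1 + Complex.I * (A + B) Complex.I =
      e * (((α' x - q * α x : ℝ) : ℂ) + ((β' x - p * β x : ℝ) : ℂ) * v) := by
    simp only [add_apply, hA1, hB1, hAI, hBI, hev, hre]
    push_cast
    linear_combination (q * α x * e + p * β x * e * v) * I2
  have e2 : (A + B) 1 - Complex.I * (A + B) Complex.I =
      e * (((α' x + q * α x : ℝ) : ℂ) + ((β' x + p * β x : ℝ) : ℂ) * v) := by
    simp only [add_apply, hA1, hB1, hAI, hBI, hev, hre]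
    push_cast
    linear_combination -(q * α x * e + p * β x * e * v) * I2
  rw [BeltramiBound, e1, e2, norm_mul, norm_mul, he1, one_mul, one_mul]
  exact norm_add_mul_le_of_abs_le hv1 hk h₁ h₂

/-- A smooth map interpolating between `z ^ q` and `z ^ p` on `1 ≤ |z| ≤ e ^ (π / q)`. -/
theorem exists_model {q p : ℕ} (hq : 0 < q) (hqp : q < p) :
    ∃ (g : ℂ → ℂ) (k : ℝ), 0 ≤ k ∧ k < 1 ∧ ContDiffOn ℝ 1 g {0}ᶜ ∧
      (∀ z : ℂ, ‖z‖ = 1 → g z = z ^ q) ∧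
      (∀ z : ℂ, ‖z‖ = Real.exp (Real.pi / q) → g z = z ^ p) ∧
      (∀ z ∈ closedAnnulus 1 (Real.exp (Real.pi / q)), ‖g z‖ ≤ Real.exp (p * Real.pi / q)) ∧
      ∀ z ∈ openAnnulus 1 (Real.exp (Real.pi / q)), BeltramiBound k (fderiv ℝ g z) := by
  have hqR : (0 : ℝ) < q := Nat.cast_pos.2 hq
  have hqpR : (q : ℝ) < p := Nat.cast_lt.2 hqp
  set ℓ : ℝ := Real.pi / q with hℓ
  have hℓ0 : 0 < ℓ := div_pos Real.pi_pos hqR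
  obtain ⟨α, β, α', β', Λ, k, hα, hβ, hα', hβ', hΛ, hk0, hk1, hα0, hβ0, hαℓ, hβℓ, hx⟩ :=
    exists_profile hqR hqpR hℓ0
  have hR : 2 ≤ Real.exp (p * Real.pi / q) := by
    have h1 : Real.pi ≤ p * Real.pi / q := by
      rw [le_div_iff₀ hqR, mul_comm]
      exact mul_le_mul_of_nonneg_right hqpR.le Real.pi_pos.le
    linarith [Real.add_one_le_exp (p * Real.pi / q), Real.pi_gt_three]
  obtain ⟨γ, hγ, hγΛ⟩ := exists_stretch_exponent hΛ hR
  have hdir (z : ℂ) (hz : z ≠ 0) : ‖z / (‖z‖ : ℂ)‖ = 1 := by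
    rw [norm_div, Complex.norm_real, norm_norm, div_self (norm_ne_zero_iff.2 hz)]
  have hΛ0 : 0 < Λ := by linarith
  have hnormΛ : ‖radialStretch γ (Λ : ℂ)‖ = Real.exp (p * Real.pi / q) := by
    rw [norm_radialStretch, Complex.norm_real, Real.norm_of_nonneg hΛ0.le, hγΛ]
  have hγ0 : 0 ≤ |γ| / (1 + γ) := div_nonneg (abs_nonneg _) (by linarith)
  have hγ1 := abs_div_one_add_lt_one hγ
  have hmodel := twoModeMap_contDiffOn hα hβ q p
  have hlog {z : ℂ} (h : ‖z‖ ∈ Icc 1 (Real.exp ℓ)) : z ≠ 0 ∧ Real.log ‖z‖ ∈ Icc 0 ℓ := by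
    have hz : 0 < ‖z‖ := one_pos.trans_le h.1
    refine ⟨norm_pos_iff.1 hz, Real.log_nonneg h.1, ?_⟩
    rw [Real.log_le_iff_le_exp hz]
    exact h.2
  refine ⟨fun z => radialStretch γ (twoModeMap α β q p z),
    (|γ| / (1 + γ) + k) / (1 + |γ| / (1 + γ) * k), by positivity, ?_,
    (radialStretch_contDiff γ).comp_contDiffOn hmodel, ?_, ?_, ?_, ?_⟩
  · rw [div_lt_one (by positivity)]
    nlinarith
  · intro z hz
    have h : twoModeMap α β q p z = z ^ q := by
      simp [twoModeMap, hz, hα0, hβ0]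
    simp only [h]
    exact radialStretch_of_norm_eq_one γ (by rw [norm_pow, hz, one_pow])
  · intro z hz
    have hz0 : z ≠ 0 := norm_pos_iff.1 (hz ▸ Real.exp_pos _)
    have h : twoModeMap α β q p z = Λ * (z / ‖z‖) ^ p := by
      simp [twoModeMap, hz, hαℓ, hβℓ]
    have hn : ‖twoModeMap α β q p z‖ = Λ := by
      rw [h, norm_mul, norm_pow, hdir z hz0, one_pow, mul_one, Complex.norm_real,
        Real.norm_of_nonneg hΛ0.le]
    have hzp : ‖z‖ ^ p = Real.exp (p * Real.pi / q) := by
      rw [hz, ← Real.exp_nat_mul, hℓ, mul_div_assoc]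
    simp only [radialStretch, hn]
    rw [h, Complex.real_smul, ← mul_assoc, ← Complex.ofReal_mul, hγΛ, ← hzp, div_pow,
      Complex.ofReal_pow]
    exact mul_div_cancel₀ _ (pow_ne_zero _ (by simpa using hz0))
  · intro z hz
    obtain ⟨hz0, hl⟩ := hlog hz
    obtain ⟨ha, hb, hab, -⟩ := hx _ hl
    refine (norm_radialStretch_mono hγ ?_).trans hnormΛ.le
    rw [Complex.norm_real, Real.norm_of_nonneg hΛ0.le]
    refine le_trans ((norm_add_le _ _).trans_eq ?_) hab
    rw [norm_mul, norm_mul, norm_pow, norm_pow, hdir z hz0, one_pow, one_pow, mul_one, mul_one,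
      Complex.norm_real, Complex.norm_real, Real.norm_of_nonneg ha, Real.norm_of_nonneg hb]
  · intro z hz
    obtain ⟨hz0, hl⟩ := hlog ⟨hz.1.le, hz.2.le⟩
    obtain ⟨-, -, -, h₁, h₂⟩ := hx _ hl
    have hd : DifferentiableAt ℝ (twoModeMap α β q p) z :=
      (hmodel.differentiableOn one_ne_zero).differentiableAt
        (isOpen_compl_singleton.mem_nhds hz0)
    have hd' : DifferentiableAt ℝ (radialStretch γ) (twoModeMap α β q p z) :=
      (radialStretch_contDiff γ).differentiable one_ne_zero _
    have hf := (hd'.hasFDerivAt.comp z hd.hasFDerivAt).fderiv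
    have hf' : fderiv ℝ (fun z => radialStretch γ (twoModeMap α β q p z)) z = _ := hf
    rw [hf']
    exact (beltramiBound_fderiv_radialStretch hγ _).comp
      (beltramiBound_fderiv_twoModeMap hα hβ hk0 hqp.le hz0 hα' hβ' rfl h₁ h₂) hγ0 hγ1 hk0 hk1

/-! ### Transfer to general radius, factor and degrees -/

theorem isOpen_openAnnulus (a b : ℝ) : IsOpen (openAnnulus a b) :=
  (isOpen_lt continuous_const continuous_norm).inter (isOpen_lt continuous_norm continuous_const)

theorem openAnnulus_subset_compl_zero {a b : ℝ} (ha : 0 ≤ a) : openAnnulus a b ⊆ {0}ᶜ := by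
  intro z hz h
  have h0 : z = 0 := h
  have := hz.1
  rw [h0, norm_zero] at this
  linarith

theorem contDiffOn_mul_comp_pow {g : ℂ → ℂ} (hg : ContDiffOn ℝ 1 g {0}ᶜ) (C : ℂ) {r : ℝ}
    (hr : 0 < r) (d : ℕ) : ContDiffOn ℝ 1 (fun z => C * g ((z / r) ^ d)) {0}ᶜ := by
  have hP : ContDiff ℝ 1 (fun z : ℂ => (z / r) ^ d) := by
    simp only [div_eq_mul_inv]
    fun_prop
  refine contDiffOn_const.mul (hg.comp hP.contDiffOn ?_)
  intro z hz
  exact pow_ne_zero _ (div_ne_zero hz (Complex.ofReal_ne_zero.2 hr.ne'))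

theorem isKQuasiregularOn_mul_comp_pow_iff {g : ℂ → ℂ} (hg : ContDiffOn ℝ 1 g {0}ᶜ) {C : ℂ}
    (hC : C ≠ 0) {r ρ K : ℝ} (hr : 0 < r) (hρ : 0 ≤ ρ) {d : ℕ} (hd : d ≠ 0) :
    IsKQuasiregularOn K (fun z => C * g ((z / r) ^ d)) (openAnnulus r (r * ρ)) ↔
      IsKQuasiregularOn K g (openAnnulus 1 (ρ ^ d)) := by
  have hrC : (r : ℂ) ≠ 0 := Complex.ofReal_ne_zero.2 hr.ne'
  rw [isKQuasiregularOn_iff_of_contDiffOn (isOpen_openAnnulus _ _)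
      ((contDiffOn_mul_comp_pow hg C hr d).mono (openAnnulus_subset_compl_zero hr.le)),
    isKQuasiregularOn_iff_of_contDiffOn (isOpen_openAnnulus _ _)
      (hg.mono (openAnnulus_subset_compl_zero zero_le_one))]
  have hbound (k : ℝ) {z : ℂ} (hz : z ≠ 0) :
      BeltramiBound k (fderiv ℝ (fun z => C * g ((z / r) ^ d)) z) ↔
        BeltramiBound k (fderiv ℝ g ((z / r) ^ d)) := by
    have hzr : z / r ≠ 0 := div_ne_zero hz hrC
    have hP : HasDerivAt (fun z : ℂ => (z / r) ^ d) (d * (z / r) ^ (d - 1) * (1 / r)) z :=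
      ((hasDerivAt_id z).div_const (r : ℂ)).pow d
    have hg' : HasFDerivAt g (fderiv ℝ g ((z / r) ^ d)) ((z / r) ^ d) :=
      ((hg.differentiableOn one_ne_zero).differentiableAt
        (isOpen_compl_singleton.mem_nhds (pow_ne_zero _ hzr))).hasFDerivAt
    have h := (HasFDerivAt.comp_hasDerivAt_complex (P := fun z : ℂ => (z / r) ^ d)
      hg' hP).const_mul C
    rw [h.fderiv, beltramiBound_smul_iff hC, beltramiBound_comp_smul_one_iff]
    exact mul_ne_zero (mul_ne_zero (Nat.cast_ne_zero.2 hd) (pow_ne_zero _ hzr))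
      (one_div_ne_zero hrC)
  have hmem (z : ℂ) : z ∈ openAnnulus r (r * ρ) ↔ (z / r) ^ d ∈ openAnnulus 1 (ρ ^ d) := by
    have hn : ‖(z / r) ^ d‖ = (‖z‖ / r) ^ d := by
      rw [norm_pow, norm_div, Complex.norm_real, Real.norm_of_nonneg hr.le]
    simp only [openAnnulus, mem_ofPred_eq, hn]
    rw [one_lt_pow_iff_of_nonneg (by positivity) hd, one_lt_div hr,
      pow_lt_pow_iff_left₀ (by positivity) hρ hd, div_lt_iff₀ hr, mul_comm ρ]
  refine and_congr_right fun _ => ⟨fun h w hw => ?_, fun h z hz => ?_⟩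
  -- Every point of the model annulus has a d-th root, so bounds also pass back to g.
  · obtain ⟨ξ, hξ⟩ := IsAlgClosed.exists_pow_nat_eq w (Nat.pos_of_ne_zero hd)
    have hξ' : ((r * ξ) / r) ^ d = w := by rw [mul_div_cancel_left₀ _ hrC, hξ]
    have hz : (r : ℂ) * ξ ∈ openAnnulus r (r * ρ) := by rwa [hmem, hξ']
    have := (hbound _ (openAnnulus_subset_compl_zero hr.le hz)).1 (h _ hz)
    rwa [hξ'] at this
  · exact (hbound _ (openAnnulus_subset_compl_zero hr.le hz)).2 (h _ ((hmem z).1 hz))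

theorem exists_eq_mul_of_natCast_div {M n : ℕ} (hn : 0 < n) :
    ∃ d : ℕ, d ≠ 0 ∧ n = d * ((M : ℚ) / n).den ∧ M = d * ((M : ℚ) / n).num.natAbs := by
  set m : ℚ := (M : ℚ) / n with hm
  have hm0 : 0 ≤ m := by positivity
  have hnum : (m.num.natAbs : ℚ) = m.num := by
    rw [Nat.cast_natAbs, abs_of_nonneg (Rat.num_nonneg.2 hm0)]
  have hcross : m.num.natAbs * n = M * m.den := by
    have h1 : (m.num.natAbs : ℚ) / m.den = (M : ℚ) / n := by rw [hnum, Rat.num_div_den]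
    rw [div_eq_div_iff (Nat.cast_ne_zero.2 m.den_nz) (Nat.cast_ne_zero.2 hn.ne')] at h1
    exact_mod_cast h1
  obtain ⟨d, hd⟩ := m.reduced.symm.dvd_of_dvd_mul_left (Dvd.intro_left M hcross.symm)
  refine ⟨d, ?_, by rw [hd, mul_comm], ?_⟩
  · rintro rfl
    omega
  · rw [hd] at hcross
    exact Nat.eq_of_mul_eq_mul_right m.den_pos (by rw [← hcross]; ring)

theorem mainTheorem5 :
    ∃ κ : ℚ → ℝ, ∀ (r : ℝ) (c : ℂ) (n M : ℕ), 0 < r → c ≠ 0 → 0 < n → n < M →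
      ∃ g : ℂ → ℂ,
        ContinuousOn g (closedAnnulus r (r * Real.exp (Real.pi / n))) ∧
        IsQuasiregularOn g (openAnnulus r (r * Real.exp (Real.pi / n))) ∧
        MapsTo g (closedAnnulus r (r * Real.exp (Real.pi / n)))
          {w : ℂ | ‖w‖ ≤ ‖c‖ * r ^ n * Real.exp (M * Real.pi / n)} ∧
        (∀ z : ℂ, ‖z‖ = r → g z = c * z ^ n) ∧
        (∀ z : ℂ, ‖z‖ = r * Real.exp (Real.pi / n) →
          g z = c * z ^ M / (r : ℂ) ^ (M - n)) ∧
        dilatationConst g (openAnnulus r (r * Real.exp (Real.pi / n))) = κ ((M : ℚ) / (n : ℚ)) := by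
  -- Outside 0 < q < p the model is arbitrary; κ is only constrained at rationals greater than 1.
  choose! model k hk0 hk1 hmodel hinner houter hnorm hbel using
    fun q p : ℕ => fun hq : 0 < q => fun hqp : q < p => exists_model hq hqp
  refine ⟨fun m => dilatationConst (model m.den m.num.natAbs)
    (openAnnulus 1 (Real.exp (Real.pi / m.den))), fun r c n M hr hc hn hnM => ?_⟩
  obtain ⟨d, hd, hnd, hMd⟩ := exists_eq_mul_of_natCast_div (M := M) hn
  have hq := ((M : ℚ) / n).den_pos
  dsimp only
  set q := ((M : ℚ) / n).den
  set p := ((M : ℚ) / n).num.natAbs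
  clear_value q p
  have hqp : q < p := by
    rw [hnd, hMd] at hnM
    exact lt_of_mul_lt_mul_left' hnM
  set ρ := Real.exp (Real.pi / n) with hρ
  have hqR : (q : ℝ) ≠ 0 := Nat.cast_ne_zero.2 hq.ne'
  have hdR : (d : ℝ) ≠ 0 := Nat.cast_ne_zero.2 hd
  have hρd : ρ ^ d = Real.exp (Real.pi / q) := by
    rw [hρ, ← Real.exp_nat_mul, hnd]
    congr 1
    push_cast
    field_simp
  have hexp : Real.exp (p * Real.pi / q) = Real.exp (M * Real.pi / n) := by
    rw [hnd, hMd]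
    congr 1
    push_cast
    field_simp
  have hrC : (r : ℂ) ≠ 0 := Complex.ofReal_ne_zero.2 hr.ne'
  have hC : c * (r : ℂ) ^ n ≠ 0 := mul_ne_zero hc (pow_ne_zero _ hrC)
  have hP (z : ℂ) : ‖(z / r) ^ d‖ = (‖z‖ / r) ^ d := by
    rw [norm_pow, norm_div, Complex.norm_real, Real.norm_of_nonneg hr.le]
  have hiff (K : ℝ) := isKQuasiregularOn_mul_comp_pow_iff (K := K) (hmodel q p hq hqp) hC hr
    (Real.exp_pos (Real.pi / n)).le hd
  rw [← hρ, hρd] at hiff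
  refine ⟨fun z => c * (r : ℂ) ^ n * model q p ((z / r) ^ d), ?_, ?_, ?_, ?_, ?_, ?_⟩
  · refine (contDiffOn_mul_comp_pow (hmodel q p hq hqp) _ hr d).continuousOn.mono ?_
    intro z hz h
    have h0 : z = 0 := h
    have := hz.1
    rw [h0, norm_zero] at this
    linarith
  · refine ⟨(1 + k q p) / (1 - k q p), (hiff _).2 ?_⟩
    have h0 := hk0 q p hq hqp
    have h1 : 0 < 1 - k q p := sub_pos.2 (hk1 q p hq hqp)
    rw [isKQuasiregularOn_iff_of_contDiffOn (isOpen_openAnnulus _ _)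
      ((hmodel q p hq hqp).mono (openAnnulus_subset_compl_zero zero_le_one))]
    refine ⟨(one_le_div h1).2 (by linarith), fun z hz => ?_⟩
    have hk : ((1 + k q p) / (1 - k q p) - 1) / ((1 + k q p) / (1 - k q p) + 1) = k q p := by
      field_simp
      ring
    rw [hk]
    exact hbel q p hq hqp z hz
  · intro z hz
    have hmem : (z / r) ^ d ∈ closedAnnulus 1 (Real.exp (Real.pi / q)) := by
      refine ⟨?_, ?_⟩
      · rw [hP]
        exact one_le_pow₀ ((one_le_div hr).2 hz.1)
      · rw [hP, ← hρd]
        have := hz.2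
        gcongr
        rwa [div_le_iff₀ hr, mul_comm]
    have := hnorm q p hq hqp _ hmem
    rw [hexp] at this
    simp only [mem_ofPred_eq, norm_mul, norm_pow, Complex.norm_real, Real.norm_of_nonneg hr.le]
    gcongr
  · intro z hz
    have h1 : ‖(z / r) ^ d‖ = 1 := by rw [hP, hz, div_self hr.ne', one_pow]
    simp only [hinner q p hq hqp _ h1]
    rw [← pow_mul, ← hnd, div_pow]
    field_simp
  · intro z hz
    have h1 : ‖(z / r) ^ d‖ = Real.exp (Real.pi / q) := by
      rw [hP, hz, mul_div_cancel_left₀ _ hr.ne', hρd]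
    simp only [houter q p hq hqp _ h1]
    rw [← pow_mul, ← hMd, div_pow, pow_sub₀ _ hrC hnM.le]
    field_simp
  -- The sets of admissible K coincide, hence so do their infima.
  · simp only [dilatationConst, hiff]
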